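/- Let $K$ be an infinite field. For a finite quiver $Q$ and a dimension vector $\alpha\in\mathbb Z_{\ge0}^{Q_0}$ let $\operatorname{Rep}(Q,\alpha)=\prod_{a:x\to y}\operatorname{Mat}_{\alpha(y),\alpha(x)}(K)$, on which $\operatorname{GL}(\alpha)=\prod_x\operatorname{GL}_{\alpha(x)}(K)$ acts by $(A\cdot V)(a)=A(y)V(a)A(x)^{-1}$ for $a:x\to y$; let $\operatorname{SL}(\alpha)=\prod_x\operatorname{SL}_{\alpha(x)}(K)$ and let $\operatorname{SI}(Q,\alpha)=K[\operatorname{Rep}(Q,\alpha)]^{\operatorname{SL}(\alpha)}$ be the ring of semi-invariants. The semi-invariants of weight $\sigma\in\mathbb Z^{Q_0}$ form the space $\operatorname{SI}(Q,\alpha)_\sigma=\{f: A\cdot f=\prod_x\det(A(x))^{\sigma(x)}f\ \ \forall A\in\operatorname{GL}(\alpha)\}$, where $(A\cdot f)(V)=f(A^{-1}\cdot V)$. Put $|\sigma|_\alpha=\sum_x\max(\sigma(x),0)\,\alpha(x)$. The null cone is the common zero set in $\operatorname{Rep}(Q,\alpha)$ of all homogeneous elements of positive degree of $\operatorname{SI}(Q,\alpha)$.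 A set of weights is said to define the null cone if the common zero set of the semi-invariants of the nonzero weights in it is the null cone, and to generate $\operatorname{SI}(Q,\alpha)$ if the semi-invariants of these weights generate it as a $K$-algebra. A representation $V$ is $\sigma$-semistable if $f(V)\ne0$ for some $d\ge1$ and some $f\in\operatorname{SI}(Q,\alpha)_{d\sigma}$. For $n\ge2$ let $Q_n$ be the quiver with vertices $1,\dots,n$ and exactly two arrows from every even vertex to each odd vertex adjacent to it (that is, differing from it by $1$), and no other arrows; let $\alpha=(2,3,\dots,3,1)$ (so $\alpha=(2,1)$ if $n=2$). **Proposition 1.5.** (a) For every $n\ge2$, the weights $\sigma$ with $|\sigma|_\alpha<2^n-2$ do not define the null cone in $\operatorname{Rep}(Q_n,\alpha)$, and they do not generate $\operatorname{SI}(Q_n,\alpha)$. (b) For every $n\ge2$ there is a representation $R\in\operatorname{Rep}(Q_n,\alpha)$ that is not in the null cone and on which all semi-invariants of nonzero weights $\sigma$ with $|\sigma|_\alpha<2^n-2$ vanish, such that $R$ is $\sigma$-semistable if and only if $\sigma$ is a nonnegative integer multiple of $(-1,2,-4,8,\dots)$, and such that $R$ is the direct sum of representations $R_1,\dots,R_{n-1}$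 of the following form: $R_k$ has dimension $2$ at vertex $k$, dimension $1$ at vertex $k+1$ and $0$ elsewhere, and its two arrows between these vertices are given by $\binom10,\binom01$ if $k$ is odd and by $(1\ 0),(0\ 1)$ if $k$ is even. (c) Consequently there is no polynomial bound: for every polynomial $P\in\mathbb R[X]$ and all sufficiently large $n$, the weights $\sigma$ with $|\sigma|_\alpha\le P(n)$ neither define the null cone in $\operatorname{Rep}(Q_n,\alpha)$ nor generate $\operatorname{SI}(Q_n,\alpha)$. -/

import Mathlib

universe u v w

namespace QuiverSI

section General

/-- The representation space `Rep(Q, α)`: one `α(y) × α(x)` matrix for every arrow `x ⟶ y`. -/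
abbrev Rep (K : Type w) (Q : Type u) [Quiver.{v} Q] (α : Q → ℕ) : Type _ :=
  ∀ ⦃x y : Q⦄, (x ⟶ y) → Matrix (Fin (α y)) (Fin (α x)) K

/-- The matrix entries, that is, the coordinates on `Rep(Q, α)`. -/
structure Coord (Q : Type u) [Quiver.{v} Q] (α : Q → ℕ) where
  {src : Q}
  {tgt : Q}
  arr : src ⟶ tgt
  row : Fin (α tgt)
  col : Fin (α src)

/-- The coordinate ring `K[Rep(Q, α)]`. -/
abbrev CoordRing (K : Type w) [Field K] (Q : Type u) [Quiver.{v} Q] (α : Q → ℕ) : Type _ :=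
  MvPolynomial (Coord Q α) K

/-- `GL(α) = ∏ₓ GL_{α(x)}(K)`. -/
abbrev GLdim (K : Type w) [Field K] (Q : Type u) (α : Q → ℕ) : Type _ :=
  ∀ x : Q, Matrix.GeneralLinearGroup (Fin (α x)) K

variable {K : Type w} [Field K] {Q : Type u} [Quiver.{v} Q] {α : Q → ℕ}

/-- The action of `GL(α)` on `Rep(Q, α)`: `(A · V)(a) = A(ha) V(a) A(ta)⁻¹`. -/
def act (A : GLdim K Q α) (V : Rep K Q α) : Rep K Q α :=
  fun x y a => (A y).val * V a * ((A x)⁻¹).val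

/-- The value `f(V)` of a polynomial function on `Rep(Q, α)`. -/
noncomputable def value (V : Rep K Q α) (f : CoordRing K Q α) : K :=
  MvPolynomial.eval (fun c : Coord Q α => V c.arr c.row c.col) f

/-- The ring of semi-invariants `SI(Q, α) = K[Rep(Q, α)]^{SL(α)}`, for the action
`(A · f)(V) = f(A⁻¹ · V)`.  (The field `K` is infinite in all uses, so that a polynomial is
determined by its values.) -/
noncomputable def SI (K : Type w) [Field K] (Q : Type u) [Quiver.{v} Q] (α : Q → ℕ) :
    Subalgebra K (CoordRing K Q α) where
  carrier := {f | ∀ A : GLdim K Q α, (∀ x, Matrix.GeneralLinearGroup.det (A x) = 1) →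
    ∀ V : Rep K Q α, value (act A⁻¹ V) f = value V f}
  mul_mem' := by
    intro f g hf hg A hA V
    have h1 := hf A hA V
    have h2 := hg A hA V
    simp only [value, map_mul] at h1 h2 ⊢
    rw [h1, h2]
  add_mem' := by
    intro f g hf hg A hA V
    have h1 := hf A hA V
    have h2 := hg A hA V
    simp only [value, map_add] at h1 h2 ⊢
    rw [h1, h2]
  algebraMap_mem' := by
    intro r A hA V
    simp [value, MvPolynomial.algebraMap_eq]

/-- The null cone: the common zero set of the homogeneous elements of positive degree of
`SI(Q, α)`. -/
def nullCone (K : Type w) [Field K] (Q : Type u) [Quiver.{v} Q] (α : Q → ℕ) :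
    Set (Rep K Q α) :=
  {V | ∀ f ∈ SI K Q α, ∀ d : ℕ, 0 < d → f.IsHomogeneous d → value V f = 0}

/-- `R` is the direct sum of the family of representations `V i`: after a suitable numbering of
the standard basis at each vertex, all matrices of `R` are block diagonal with blocks `V i a`. -/
def IsDirectSum {ι : Type} [DecidableEq ι] {β : ι → Q → ℕ}
    (V : ∀ i, Rep K Q (β i)) (R : Rep K Q α) : Prop :=
  ∃ e : ∀ x : Q, (Σ i : ι, Fin (β i x)) ≃ Fin (α x),
    ∀ ⦃x y : Q⦄ (a : x ⟶ y),
      R a = Matrix.reindex (e y) (e x) (Matrix.blockDiagonal' fun i => V i a)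

variable [Fintype Q]

/-- The character `χ_σ(A) = ∏ₓ det(A(x))^{σ(x)}` of `GL(α)`. -/
noncomputable def character (σ : Q → ℤ) (A : GLdim K Q α) : Kˣ :=
  ∏ x, Matrix.GeneralLinearGroup.det (A x) ^ σ x

/-- The weight space `SI(Q, α)_σ = {f | A · f = χ_σ(A) f for all A ∈ GL(α)}`, where
`(A · f)(V) = f(A⁻¹ · V)`. -/
noncomputable def SIweight (K : Type w) [Field K] {Q : Type u} [Quiver.{v} Q] [Fintype Q]
    (α : Q → ℕ) (σ : Q → ℤ) : Submodule K (CoordRing K Q α) where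
  carrier := {f | ∀ (A : GLdim K Q α) (V : Rep K Q α),
    value (act A⁻¹ V) f = (character σ A : K) * value V f}
  add_mem' := by
    intro f g hf hg A V
    have h1 := hf A V
    have h2 := hg A V
    simp only [value, map_add] at h1 h2 ⊢
    rw [h1, h2, mul_add]
  zero_mem' := by
    intro A V
    simp [value]
  smul_mem' := by
    intro c f hf A V
    have h1 := hf A V
    simp only [value, MvPolynomial.smul_eval] at h1 ⊢
    rw [h1, mul_left_comm]

/-- `|σ|_α = σ₊ · α`, where `σ₊(x) = max(σ(x), 0)`.  It is of interest only if `σ · α = 0`, since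
otherwise `SI(Q, α)_σ = 0`. -/
def weightSize (α : Q → ℕ) (σ : Q → ℤ) : ℤ :=
  ∑ x, max (σ x) 0 * (α x : ℤ)

/-- The semi-invariants of the nonzero weights in `S` define the null cone.  (The weight `0` is
left out: the constants, which have no zero, are semi-invariants of weight `0`.) -/
def DefineNullCone (K : Type w) [Field K] (α : Q → ℕ) (S : Set (Q → ℤ)) : Prop :=
  {V : Rep K Q α | ∀ σ ∈ S, σ ≠ 0 → ∀ f ∈ SIweight K α σ, value V f = 0} = nullCone K Q α

/-- The semi-invariants of the weights in `S` generate the `K`-algebra `SI(Q, α)`. -/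
def GenerateSI (K : Type w) [Field K] (α : Q → ℕ) (S : Set (Q → ℤ)) : Prop :=
  Algebra.adjoin K (⋃ σ ∈ S, (SIweight K α σ : Set (CoordRing K Q α))) = SI K Q α

/-- `V` is `σ`-semistable: some semi-invariant of weight `dσ`, `d ≥ 1`, does not vanish at `V`. -/
def Semistable (V : Rep K Q α) (σ : Q → ℤ) : Prop :=
  ∃ d : ℕ, 0 < d ∧ ∃ f ∈ SIweight K α (d • σ), value V f ≠ 0

end General

section ZigzagQuiver

/-- The vertices of the zigzag quiver `Q_n`.  (A copy of `Fin n`, which as an ordered set already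
carries another quiver structure.) -/
def Zigzag (n : ℕ) : Type := Fin n

instance (n : ℕ) : Fintype (Zigzag n) := inferInstanceAs (Fintype (Fin n))

instance (n : ℕ) : DecidableEq (Zigzag n) := inferInstanceAs (DecidableEq (Fin n))

/-- The vertices are numbered `1, …, n`. -/
def Zigzag.label {n : ℕ} (x : Zigzag n) : ℕ := Fin.val (n := n) x + 1

/-- Two arrows (numbered `0`, `1`) from each even vertex to each neighbouring odd vertex. -/
instance (n : ℕ) : Quiver.{0} (Zigzag n) where
  Hom x y := {_b : Fin 2 // Even x.label ∧ (y.label = x.label + 1 ∨ x.label = y.label + 1)}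

/-- The dimension vector `(2, 3, …, 3, 1)`. -/
def zigzagDim (n : ℕ) (x : Zigzag n) : ℕ :=
  if x.label = 1 then 2 else if x.label = n then 1 else 3

/-- The weight `(-1, 2, -4, 8, …)`. -/
def zigzagWeight (n : ℕ) (x : Zigzag n) : ℤ :=
  (-1) ^ x.label * 2 ^ (x.label - 1)

/-- The dimension vector with entry `2` at vertex `k`, entry `1` at vertex `k + 1`, and `0`
elsewhere. -/
def kroneckerDim (n k : ℕ) (x : Zigzag n) : ℕ :=
  if x.label = k then 2 else if x.label = k + 1 then 1 else 0

/-- The representation of `Q_n` supported on the Kronecker subquiver with vertices `k`, `k + 1`: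
for odd `k` the two arrows `k + 1 ⟶ k` act as the columns `(1, 0)ᵀ` and `(0, 1)ᵀ`, for even `k`
the two arrows `k ⟶ k + 1` act as the rows `(1, 0)` and `(0, 1)`. -/
def kroneckerRep (K : Type w) [Field K] (n k : ℕ) : Rep K (Zigzag n) (kroneckerDim n k) :=
  fun x y a => Matrix.of fun p q =>
    if (y.label = k ∧ x.label = k + 1 ∧ p.val = a.val.val) ∨
       (x.label = k ∧ y.label = k + 1 ∧ q.val = a.val.val) then 1 else 0

end ZigzagQuiver

end QuiverSI

/-!
The representation `R` is the direct sum of the Kronecker representations `R_k`, and everything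
follows from two facts about it.

*Only multiples of `w = (-1, 2, -4, 8, …)` see `R`.* Multiplying the summand `R_k` by a unit is an
automorphism of `R`, so a semi-invariant of weight `σ` that does not vanish at `R` satisfies
`2 σ(k) + σ(k + 1) = 0` for all `k`, that is, `σ = c w` (`value_ne_zero_relation`). All arrows run
from even to odd vertices, so multiplying `R` by a scalar `u` is also the action of a group element,
and it multiplies the value by `u ^ (c (2 ^ n - 2))`; this is a polynomial in `u`, hence `c ≥ 0`
(`exists_eq_nsmul_of_value_ne_zero`). As `|w| = 2 ^ n - 2`, semi-invariants of smaller nonzero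
weights vanish at `R`.

*The weight `w` itself sees `R`.* Take every vertex `x` with multiplicity `|w(x)| = 2 ^ (x - 1)`.
The determinant of a square block matrix, from the even to the odd vertices, whose blocks are
combinations of the arrows is a semi-invariant of weight `w`. At `R` it splits into blocks of size
`2 ^ k` for the summands `R_k`, and the coefficients can be chosen such that each block is a
permutation matrix (`blockMatrix_kroneckerSum`). The rows and the columns are numbered by the same
index set accordingly, and the determinant takes the value `1` at `R`.

So `R` is not in the null cone, while small weights do not tell `R` from the zero representation
(`value_kroneckerSum_eq_value_zero`), at which the determinant vanishes; hence they do not generate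
the ring of semi-invariants.
-/

namespace QuiverSI

open Matrix

/-! ### Vertices of the zigzag quiver and dimension vectors -/

section Vertices

variable {n : ℕ}

theorem Zigzag.ext {x y : Zigzag n} (h : x.label = y.label) : x = y :=
  Fin.ext (Nat.succ_injective h)

theorem Zigzag.label_pos (x : Zigzag n) : 0 < x.label := Nat.succ_pos _

theorem Zigzag.label_le (x : Zigzag n) : x.label ≤ n := Fin.isLt (n := n) x

/-- The vertex with label `k + 1`, which carries the two-dimensional space of the `k`-th summand
(counted from `0`). -/
def planeVertex (k : Fin (n - 1)) : Zigzag n := (⟨k, by omega⟩ : Fin n)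

/-- The vertex with label `k + 2`, which carries the line of the `k`-th summand
(counted from `0`). -/
def lineVertex (k : Fin (n - 1)) : Zigzag n := (⟨k + 1, by omega⟩ : Fin n)

@[simp] theorem label_planeVertex (k : Fin (n - 1)) : (planeVertex k).label = k + 1 := rfl

@[simp] theorem label_lineVertex (k : Fin (n - 1)) : (lineVertex k).label = k + 2 := rfl

theorem sum_kroneckerDim (hn : 2 ≤ n) (x : Zigzag n) :
    ∑ k : Fin (n - 1), kroneckerDim n (k + 1) x = zigzagDim n x := by
  have h1 := x.label_pos
  have h2 := x.label_le
  have key : ∀ k : ℕ, kroneckerDim n (k + 1) x =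
      (if x.label - 1 = k then 2 else 0) + (if k + 2 = x.label then 1 else 0) := by
    intro k
    unfold kroneckerDim
    split_ifs <;> omega
  rw [Fin.sum_univ_eq_sum_range (fun k => kroneckerDim n (k + 1) x)]
  simp only [key, Finset.sum_add_distrib, Finset.sum_ite_eq, Finset.mem_range]
  unfold zigzagDim
  rcases Nat.lt_or_ge x.label 2 with h | h
  · have h3 : x.label = 1 := by omega
    rw [Finset.sum_eq_zero (fun k _ => if_neg (by omega))]
    simp [h3]
    omega
  · have h4 : ∀ k : ℕ, (k + 2 = x.label) = (x.label - 2 = k) := fun k => by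
      apply propext; omega
    simp only [h4, Finset.sum_ite_eq, Finset.mem_range]
    split_ifs <;> omega

theorem sum_kroneckerDim_mul (k : Fin (n - 1)) (g : Zigzag n → ℤ) :
    ∑ x, (kroneckerDim n (k + 1) x : ℤ) * g x = 2 * g (planeVertex k) + g (lineVertex k) := by
  have key : ∀ x, (kroneckerDim n (k + 1) x : ℤ) * g x =
      (if x = planeVertex k then 2 * g x else 0) + (if x = lineVertex k then g x else 0) := by
    intro x
    have h1 : x = planeVertex k ↔ x.label = k + 1 :=
      ⟨fun h => by rw [h]; rfl, fun h => Zigzag.ext h⟩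
    have h2 : x = lineVertex k ↔ x.label = k + 1 + 1 :=
      ⟨fun h => by rw [h]; rfl, fun h => Zigzag.ext h⟩
    simp only [h1, h2, kroneckerDim]
    split_ifs <;> omega
  simp only [key, Finset.sum_add_distrib, Finset.sum_ite_eq', Finset.mem_univ, if_true]

/-- Splitting `α` into the dimension vectors of the Kronecker summands. -/
theorem sum_zigzagDim_mul (hn : 2 ≤ n) (g : Zigzag n → ℤ) :
    ∑ x, (zigzagDim n x : ℤ) * g x =
      ∑ k : Fin (n - 1), (2 * g (planeVertex k) + g (lineVertex k)) := by
  simp only [← sum_kroneckerDim_mul, ← sum_kroneckerDim hn, Nat.cast_sum, Finset.sum_mul]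
  exact Finset.sum_comm

theorem sum_two_pow_succ (hn : 2 ≤ n) :
    ∑ k : Fin (n - 1), (2 : ℤ) ^ (k.val + 1) = 2 ^ n - 2 := by
  obtain ⟨m, rfl⟩ := Nat.exists_eq_add_of_le' hn
  rw [Fin.sum_univ_eq_sum_range (fun k => (2 : ℤ) ^ (k + 1))]
  have := geom_sum_mul (2 : ℤ) (m + 1)
  simp only [pow_succ, ← Finset.sum_mul] at this ⊢
  simp only [Nat.add_succ_sub_one]
  linarith

theorem even_label_lineVertex (k : Fin (n - 1)) :
    Even (lineVertex k).label ↔ ¬ Even (planeVertex k).label := by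
  simp [Nat.even_add_one, parity_simps]

/-- If a vertex set contains exactly one of any two neighbours, then the spaces at its vertices,
taken with multiplicity `2 ^ (label - 1)`, have total dimension `2 ^ n - 2`: the `k`-th
summand contributes `2 ^ (k + 1)` at either of its two vertices. -/
theorem sum_zigzagDim_mul_two_pow (hn : 2 ≤ n) (p : Zigzag n → Prop) [DecidablePred p]
    (hp : ∀ k : Fin (n - 1), p (lineVertex k) ↔ ¬ p (planeVertex k)) :
    ∑ x, (zigzagDim n x : ℤ) * (if p x then 2 ^ (x.label - 1) else 0) = 2 ^ n - 2 := by
  rw [sum_zigzagDim_mul hn, ← sum_two_pow_succ hn]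
  refine Finset.sum_congr rfl fun k _ => ?_
  by_cases h : p (planeVertex k) <;> simp [hp, h, pow_succ, mul_comm]

theorem zigzagWeight_of_even {x : Zigzag n} (h : Even x.label) :
    zigzagWeight n x = 2 ^ (x.label - 1) := by
  simp [zigzagWeight, h.neg_one_pow]

theorem zigzagWeight_of_not_even {x : Zigzag n} (h : ¬ Even x.label) :
    zigzagWeight n x = -2 ^ (x.label - 1) := by
  simp [zigzagWeight, (Nat.not_even_iff_odd.1 h).neg_one_pow]

theorem weightSize_nsmul_zigzagWeight (hn : 2 ≤ n) (m : ℕ) :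
    weightSize (zigzagDim n) (m • zigzagWeight n) = m * (2 ^ n - 2) := by
  rw [← sum_zigzagDim_mul_two_pow hn (fun x => Even x.label) even_label_lineVertex,
    Finset.mul_sum]
  refine Finset.sum_congr rfl fun x _ => ?_
  by_cases h : Even x.label
  · have : (0 : ℤ) ≤ m * 2 ^ (x.label - 1) := by positivity
    simp [zigzagWeight_of_even h, h, this]
    ring
  · simp [zigzagWeight_of_not_even h, h]

/-- The exponent by which a semi-invariant of weight `σ` scales when a representation is multiplied
by a scalar. -/
def scalingDegree (σ : Zigzag n → ℤ) : ℤ :=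
  ∑ x, (zigzagDim n x : ℤ) * (if Even x.label then σ x else 0)

theorem scalingDegree_smul_zigzagWeight (hn : 2 ≤ n) (c : ℤ) :
    scalingDegree (c • zigzagWeight n) = c * (2 ^ n - 2) := by
  rw [← sum_zigzagDim_mul_two_pow hn (fun x => Even x.label) even_label_lineVertex,
    Finset.mul_sum]
  refine Finset.sum_congr rfl fun x _ => ?_
  by_cases h : Even x.label
  · simp [zigzagWeight_of_even h, h]
    ring
  · simp [h]

/-- The relations `2 σ(k) + σ(k + 1) = 0` determine `σ` up to its value at the first vertex. -/
theorem eq_smul_zigzagWeight (hn : 2 ≤ n) {σ : Zigzag n → ℤ}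
    (h : ∀ k : Fin (n - 1), 2 * σ (planeVertex k) + σ (lineVertex k) = 0) :
    ∃ c : ℤ, σ = c • zigzagWeight n := by
  have key : ∀ (i : ℕ) (hi : i < n),
      σ (⟨i, hi⟩ : Fin n) = σ (⟨0, by omega⟩ : Fin n) * ((-1) ^ i * 2 ^ i) := by
    intro i
    induction i with
    | zero => intro hi; rw [pow_zero, pow_zero, mul_one, mul_one]
    | succ i ih =>
      intro hi
      have h1 : 2 * σ (⟨i, _⟩ : Fin n) + σ (⟨i + 1, _⟩ : Fin n) = 0 := h ⟨i, by omega⟩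
      have h2 := ih (by omega)
      rw [pow_succ, pow_succ]
      linarith
  refine ⟨-σ (⟨0, by omega⟩ : Fin n), funext fun x => (key _ x.2).trans ?_⟩
  have h3 : zigzagWeight n x = (-1) ^ (x.1 + 1) * 2 ^ x.1 := rfl
  rw [Pi.smul_apply, h3, pow_succ, smul_eq_mul]
  ring

end Vertices

/-! ### Values of semi-invariants -/

section Values

variable {K : Type w} [Field K] {Q : Type u} [Quiver.{v} Q] {α : Q → ℕ}

theorem act_apply (A : GLdim K Q α) (V : Rep K Q α) {x y : Q} (a : x ⟶ y) :
    act A V a = (A y).val * V a * ((A x)⁻¹).val := rfl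

/-- The value of a polynomial function on the line through `V` is a polynomial in the
parameter. -/
theorem exists_eval_eq_value_smul (V : Rep K Q α) (f : CoordRing K Q α) :
    ∃ p : Polynomial K, ∀ c : K, p.eval c = value (fun x y a => c • V (x := x) (y := y) a) f := by
  refine ⟨MvPolynomial.aeval
    (fun i : Coord Q α => Polynomial.C (V i.arr i.row i.col) * Polynomial.X) f, fun c => ?_⟩
  induction f using MvPolynomial.induction_on with
  | C r => simp [value]
  | add f g hf hg =>
    rw [map_add, Polynomial.eval_add, hf, hg]
    exact (map_add _ f g).symm
  | mul_X f i hf =>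
    rw [map_mul, Polynomial.eval_mul, hf]
    simp [value, mul_comm c]

variable [Fintype Q]

theorem SIweight_le_SI (σ : Q → ℤ) {f : CoordRing K Q α} (hf : f ∈ SIweight K α σ) :
    f ∈ SI K Q α := by
  intro A hA V
  rw [hf A V]
  simp [character, hA]

theorem character_nsmul {K : Type*} [Field K] {Q : Type*} [Fintype Q] {α : Q → ℕ} (m : ℕ)
    (σ : Q → ℤ) (A : GLdim K Q α) :
    character (m • σ) A = character σ A ^ m := by
  unfold character
  rw [← Finset.prod_pow]
  refine Finset.prod_congr rfl fun x _ => ?_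
  rw [← zpow_natCast, ← _root_.zpow_mul, mul_comm]
  simp

theorem pow_mem_SIweight {σ : Q → ℤ} {f : CoordRing K Q α} (hf : f ∈ SIweight K α σ) (m : ℕ) :
    f ^ m ∈ SIweight K α (m • σ) := by
  intro A V
  have h := hf A V
  simp only [value, map_pow] at h ⊢
  rw [h, mul_pow, character_nsmul, Units.val_pow_eq_pow_val]

end Values

theorem exists_unit_zpow_ne_one (K : Type*) [Field K] [Infinite K] {m : ℤ} (hm : m ≠ 0) :
    ∃ u : Kˣ, u ^ m ≠ 1 := by
  classical
  by_contra! h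
  have hpos : 0 < m.natAbs := Int.natAbs_pos.2 hm
  have h1 : ∀ u : Kˣ, u ^ m.natAbs = 1 := by
    intro u
    rcases Int.natAbs_eq m with h2 | h2
    · rw [← zpow_natCast, ← h2, h]
    · rw [← zpow_natCast, ← neg_eq_iff_eq_neg.2 h2, _root_.zpow_neg, h, inv_one]
  -- the nonzero elements of `K` would be roots of `X ^ |m| - 1`
  refine ((Set.finite_singleton (0 : K)).infinite_compl).mono (fun r hr => ?_) (
    (Polynomial.X ^ m.natAbs - Polynomial.C 1 : Polynomial K).roots.toFinset.finite_toSet)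
  have h2 : r ^ m.natAbs = 1 := congrArg Units.val (h1 (Units.mk0 r (by simpa using hr)))
  simp [Polynomial.X_pow_sub_C_ne_zero hpos, -map_one, h2]

/-! ### Block matrices with repeated blocks -/

section Blocks

variable {K : Type*} [CommRing K] {ι : Type*} [Fintype ι] [DecidableEq ι] {β : ι → Type*}
  [∀ i, Fintype (β i)] {γ : Type*}

theorem blockDiagonal'_mul_apply (D : ∀ i, Matrix (β i) (β i) K) (M : Matrix (Σ i, β i) γ K)
    (r : Σ i, β i) (c : γ) :
    (blockDiagonal' D * M) r c = ∑ j, D r.1 r.2 j * M ⟨r.1, j⟩ c := by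
  obtain ⟨p, i⟩ := r
  rw [Matrix.mul_apply, Fintype.sum_sigma, Finset.sum_eq_single p]
  · simp only [blockDiagonal'_apply_eq]
  · intro q _ hq
    exact Finset.sum_eq_zero fun j _ => by rw [blockDiagonal'_apply_ne _ _ _ hq.symm, zero_mul]
  · simp

theorem mul_blockDiagonal'_apply (D : ∀ i, Matrix (β i) (β i) K) (M : Matrix γ (Σ i, β i) K)
    (r : γ) (c : Σ i, β i) :
    (M * blockDiagonal' D) r c = ∑ j, M r ⟨c.1, j⟩ * D c.1 j c.2 := by
  obtain ⟨p, i⟩ := c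
  rw [Matrix.mul_apply, Fintype.sum_sigma, Finset.sum_eq_single p]
  · simp only [blockDiagonal'_apply_eq]
  · intro q _ hq
    exact Finset.sum_eq_zero fun j _ => by rw [blockDiagonal'_apply_ne _ _ _ hq, mul_zero]
  · simp

theorem det_blockDiagonal' [∀ i, DecidableEq (β i)] (D : ∀ i, Matrix (β i) (β i) K) :
    (blockDiagonal' D).det = ∏ i, (D i).det := by
  classical
  let e := Fintype.equivFin ι
  let _ : LinearOrder ι := LinearOrder.lift' e e.injective
  rw [(blockTriangular_blockDiagonal' D).det_fintype]
  refine Finset.prod_congr rfl fun i _ => ?_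
  let f : β i ≃ {a : Σ i, β i // a.1 = i} :=
    { toFun := fun b => ⟨⟨i, b⟩, rfl⟩
      invFun := fun a => a.2 ▸ a.1.2
      left_inv := fun b => rfl
      right_inv := by rintro ⟨⟨j, b⟩, rfl⟩; rfl }
  rw [← det_submatrix_equiv_self f]
  congr 1
  ext a b
  exact blockDiagonal'_apply_eq _ _ _ _

end Blocks

/-! ### The block matrix at the direct sum of the Kronecker representations -/

section SemiInvariant

variable {n : ℕ}

noncomputable instance (x y : Zigzag n) : Fintype (x ⟶ y) :=
  inferInstanceAs (Fintype {_b : Fin 2 // Even x.label ∧ (y.label = x.label + 1 ∨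
    x.label = y.label + 1)})

/-- The vertices satisfying `p`, the vertex `x` being repeated `2 ^ (x.label - 1)` times. -/
abbrev Copies (n : ℕ) (p : Zigzag n → Prop) : Type :=
  Σ x : {x : Zigzag n // p x}, Fin (2 ^ (x.1.label - 1))

/-- A basis of the direct sum of the spaces at the vertices satisfying `p`, taken with
multiplicity `2 ^ (label - 1)`. -/
abbrev CopiesBasis (n : ℕ) (p : Zigzag n → Prop) : Type :=
  Σ c : Copies n p, Fin (zigzagDim n c.1.1)

/-- The coefficient with which the arrow `a : x ⟶ y` occurs in the block from copy `s` of `x` to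
copy `t` of `y`. Copy `r` of the left one of the two vertices is joined to the copies `2 r` and
`2 r + 1` of the right one, by the arrows numbered `0` and `1`. -/
def arrowCoeff {x y : Zigzag n} (a : x ⟶ y) (s t : ℕ) : ℕ :=
  if (y.label = x.label + 1 ∧ t = 2 * s + a.val.val) ∨
    (x.label = y.label + 1 ∧ s = 2 * t + a.val.val) then 1 else 0

/-- The matrix of the map `⨁ V(x) ^ (2 ^ (x - 1)) → ⨁ V(y) ^ (2 ^ (y - 1))`, where `x` runs over
the even and `y` over the odd vertices, whose blocks are combinations of the arrows. -/
noncomputable def blockMatrix {S : Type*} [CommRing S] (V : Rep S (Zigzag n) (zigzagDim n)) :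
    Matrix (CopiesBasis n fun x => ¬ Even x.label) (CopiesBasis n fun x => Even x.label) S :=
  of fun r c => (∑ a : c.1.1.1 ⟶ r.1.1.1, arrowCoeff a c.1.2 r.1.2 • V a) r.2 c.2

theorem blockMatrix_apply {S : Type*} [CommRing S] (V : Rep S (Zigzag n) (zigzagDim n))
    (r : CopiesBasis n fun x => ¬ Even x.label) (c : CopiesBasis n fun x => Even x.label) :
    blockMatrix V r c =
      ∑ a : c.1.1.1 ⟶ r.1.1.1, (arrowCoeff a c.1.2 r.1.2 : S) * V a r.2 c.2 := by
  simp [blockMatrix, Matrix.sum_apply, nsmul_eq_mul]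

theorem blockMatrix_act {K : Type*} [Field K] (A : GLdim K (Zigzag n) (zigzagDim n))
    (V : Rep K (Zigzag n) (zigzagDim n)) :
    blockMatrix (act A V) = 
      blockDiagonal' (fun p : Copies n fun x => ¬ Even x.label => (A p.1.1).val) * blockMatrix V *
      blockDiagonal' (fun p : Copies n fun x => Even x.label => ((A p.1.1)⁻¹).val) := by
  ext r c
  rw [mul_blockDiagonal'_apply]
  simp only [blockDiagonal'_mul_apply]
  have key : ∑ a : c.1.1.1 ⟶ r.1.1.1, arrowCoeff a c.1.2 r.1.2 • act A V a =
      (A r.1.1.1).val * (∑ a : c.1.1.1 ⟶ r.1.1.1, arrowCoeff a c.1.2 r.1.2 • V a) *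
        ((A c.1.1.1)⁻¹).val := by
    rw [Matrix.mul_sum, Matrix.sum_mul]
    refine Finset.sum_congr rfl fun a _ => ?_
    rw [Matrix.mul_smul, Matrix.smul_mul]
    rfl
  refine (congrFun₂ key r.2 c.2).trans ?_
  simp only [Matrix.mul_apply]
  rfl

/-- A common index set for the rows and the columns of the block matrix: a basis of the plane of the
`k`-th summand, taken with multiplicity `2 ^ k`. -/
abbrev SummandIndex (n : ℕ) : Type := Σ k : Fin (n - 1), Fin 2 × Fin (2 ^ k.val)

theorem card_copiesBasis (hn : 2 ≤ n) (p : Zigzag n → Prop) [DecidablePred p]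
    (hp : ∀ k : Fin (n - 1), p (lineVertex k) ↔ ¬ p (planeVertex k)) :
    Fintype.card (CopiesBasis n p) = Fintype.card (SummandIndex n) := by
  have h1 : (Fintype.card (CopiesBasis n p) : ℤ) = 2 ^ n - 2 := by
    rw [← sum_zigzagDim_mul_two_pow hn p hp]
    simp only [CopiesBasis, Copies, Fintype.card_sigma, Fintype.card_fin, Fintype.sum_sigma,
      Finset.sum_const, Finset.card_univ, smul_eq_mul]
    push_cast
    rw [← Fintype.sum_subtype_add_sum_subtype p]
    rw [Finset.sum_eq_zero (s := (Finset.univ : Finset {x // ¬ p x}))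
      (fun x _ => by rw [if_neg x.2, mul_zero]), add_zero]
    exact Finset.sum_congr rfl fun x _ => by rw [if_pos x.2, mul_comm]
  have h2 : (Fintype.card (SummandIndex n) : ℤ) = 2 ^ n - 2 := by
    rw [← sum_two_pow_succ hn]
    simp [pow_succ, mul_comm]
  exact_mod_cast h1.trans h2.symm

/-- A basis of the space at `x` of the direct sum of the Kronecker representations. -/
abbrev SummandBasis (n : ℕ) (x : Zigzag n) : Type :=
  Σ k : Fin (n - 1), Fin (kroneckerDim n (k.val + 1) x)

/-- A numbering of the basis at `x`. -/
noncomputable def basisEquiv (hn : 2 ≤ n) (x : Zigzag n) : SummandBasis n x ≃ Fin (zigzagDim n x) :=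
  Fintype.equivFinOfCardEq (by simp [sum_kroneckerDim hn])

/-- The direct sum of the Kronecker representations. -/
noncomputable def kroneckerSum (K : Type*) [Field K] (hn : 2 ≤ n) :
    Rep K (Zigzag n) (zigzagDim n) :=
  fun x y a => reindex (basisEquiv hn y) (basisEquiv hn x)
    (blockDiagonal' fun k : Fin (n - 1) => kroneckerRep K n (k.val + 1) a)

theorem kroneckerDim_planeVertex (k : Fin (n - 1)) :
    kroneckerDim n (k.val + 1) (planeVertex k) = 2 := by simp [kroneckerDim]

theorem kroneckerDim_lineVertex (k : Fin (n - 1)) :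
    kroneckerDim n (k.val + 1) (lineVertex k) = 1 := by simp [kroneckerDim]

/-- The vector `b` of the plane of summand `k`, in copy `s` of the plane vertex. -/
noncomputable def planeCopy (hn : 2 ≤ n) (p : Zigzag n → Prop) (k : Fin (n - 1))
    (hk : p (planeVertex k)) (b : Fin 2) (s : Fin (2 ^ k.val)) : CopiesBasis n p :=
  ⟨⟨⟨planeVertex k, hk⟩, s.cast rfl⟩,
    basisEquiv hn _ ⟨k, b.cast (kroneckerDim_planeVertex k).symm⟩⟩

/-- The vector of the line of summand `k`, in copy `2 s + b` of the line vertex. -/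
noncomputable def lineCopy (hn : 2 ≤ n) (p : Zigzag n → Prop) (k : Fin (n - 1))
    (hk : p (lineVertex k)) (b : Fin 2) (s : Fin (2 ^ k.val)) : CopiesBasis n p :=
  ⟨⟨⟨lineVertex k, hk⟩, ⟨2 * s + b, by
      simp only [label_lineVertex, Nat.add_succ_sub_one, pow_succ]
      omega⟩⟩,
    basisEquiv hn _ ⟨k, (0 : Fin 1).cast (kroneckerDim_lineVertex k).symm⟩⟩

/-- The basis vector with a given index at the vertices satisfying `p`: it lies at the plane vertex
or at the line vertex of the summand, whichever satisfies `p`. -/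
noncomputable def copiesOfIndex (hn : 2 ≤ n) (p : Zigzag n → Prop) [DecidablePred p]
    (hp : ∀ k : Fin (n - 1), p (lineVertex k) ↔ ¬ p (planeVertex k)) (h : SummandIndex n) :
    CopiesBasis n p :=
  if hk : p (planeVertex h.1) then planeCopy hn p h.1 hk h.2.1 h.2.2
  else lineCopy hn p h.1 ((hp h.1).2 hk) h.2.1 h.2.2

theorem hom_even {x y : Zigzag n} (a : x ⟶ y) : Even x.label := a.2.1

theorem hom_not_even {x y : Zigzag n} (a : x ⟶ y) : ¬ Even y.label := by
  obtain ⟨_, hx, h | h⟩ := a <;> grind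

theorem sum_zigzag_hom {S : Type*} [AddCommMonoid S] {x y : Zigzag n} (hx : Even x.label)
    (h : y.label = x.label + 1 ∨ x.label = y.label + 1) (g : (x ⟶ y) → S) :
    ∑ a, g a = ∑ b : Fin 2, g ⟨b, hx, h⟩ :=
  (Fintype.sum_equiv ⟨fun b => (⟨b, hx, h⟩ : x ⟶ y), fun a => a.1, fun _ => rfl, fun _ => rfl⟩
    _ _ fun _ => rfl).symm

theorem not_even_lineVertex (k : Fin (n - 1)) :
    ¬ Even (lineVertex k).label ↔ ¬ ¬ Even (planeVertex k).label :=
  not_congr (even_label_lineVertex k)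

theorem kroneckerSum_apply (K : Type*) [Field K] (hn : 2 ≤ n) {x y : Zigzag n} (a : x ⟶ y)
    (k : Fin (n - 1)) (i : Fin (kroneckerDim n (k.val + 1) y))
    (j : Fin (kroneckerDim n (k.val + 1) x)) :
    kroneckerSum K hn a (basisEquiv hn y ⟨k, i⟩) (basisEquiv hn x ⟨k, j⟩) =
      kroneckerRep K n (k.val + 1) a i j := by
  simp [kroneckerSum, blockDiagonal'_apply_eq]

theorem kroneckerSum_apply_ne (K : Type*) [Field K] (hn : 2 ≤ n) {x y : Zigzag n} (a : x ⟶ y)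
    {k l : Fin (n - 1)} (hkl : k ≠ l) (i : Fin (kroneckerDim n (k.val + 1) y))
    (j : Fin (kroneckerDim n (l.val + 1) x)) :
    kroneckerSum K hn a (basisEquiv hn y ⟨k, i⟩) (basisEquiv hn x ⟨l, j⟩) = 0 := by
  simp [kroneckerSum, blockDiagonal'_apply_ne _ _ _ hkl]

theorem exists_copiesOfIndex_snd (hn : 2 ≤ n) (p : Zigzag n → Prop) [DecidablePred p]
    (hp : ∀ k : Fin (n - 1), p (lineVertex k) ↔ ¬ p (planeVertex k)) (h : SummandIndex n) :
    ∃ i, (copiesOfIndex hn p hp h).2 = basisEquiv hn _ ⟨h.1, i⟩ := by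
  by_cases hk : p (planeVertex h.1)
  · rw [copiesOfIndex, dif_pos hk]
    exact ⟨_, rfl⟩
  · rw [copiesOfIndex, dif_neg hk]
    exact ⟨_, rfl⟩

theorem blockMatrix_lineCopy_planeCopy (K : Type*) [Field K] (hn : 2 ≤ n) (k : Fin (n - 1))
    (h1 : ¬ Even (lineVertex k).label) (h2 : Even (planeVertex k).label) (b c : Fin 2)
    (s t : Fin (2 ^ k.val)) :
    blockMatrix (kroneckerSum K hn) (lineCopy hn (fun x => ¬ Even x.label) k h1 b s)
      (planeCopy hn (fun x => Even x.label) k h2 c t) = if b = c ∧ s = t then 1 else 0 := by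
  rw [blockMatrix_apply]
  refine (sum_zigzag_hom h2 (Or.inl rfl) _).trans ?_
  simp only [planeCopy, lineCopy, kroneckerSum_apply]
  simp [arrowCoeff, kroneckerRep, Fin.sum_univ_two]
  fin_cases b <;> fin_cases c <;> grind

theorem blockMatrix_planeCopy_lineCopy (K : Type*) [Field K] (hn : 2 ≤ n) (k : Fin (n - 1))
    (h1 : ¬ Even (planeVertex k).label) (h2 : Even (lineVertex k).label) (b c : Fin 2)
    (s t : Fin (2 ^ k.val)) :
    blockMatrix (kroneckerSum K hn) (planeCopy hn (fun x => ¬ Even x.label) k h1 b s)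
      (lineCopy hn (fun x => Even x.label) k h2 c t) = if b = c ∧ s = t then 1 else 0 := by
  rw [blockMatrix_apply]
  refine (sum_zigzag_hom h2 (Or.inr rfl) _).trans ?_
  simp only [planeCopy, lineCopy, kroneckerSum_apply]
  simp [arrowCoeff, kroneckerRep, Fin.sum_univ_two]
  fin_cases b <;> fin_cases c <;> grind

/-- At the direct sum of the Kronecker representations the block matrix is a permutation
matrix. -/
theorem blockMatrix_kroneckerSum (K : Type*) [Field K] (hn : 2 ≤ n) :
    (blockMatrix (kroneckerSum K hn)).submatrix
      (copiesOfIndex hn (fun x => ¬ Even x.label) not_even_lineVertex)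
      (copiesOfIndex hn (fun x => Even x.label) even_label_lineVertex) = 1 := by
  ext ⟨k, b, s⟩ ⟨l, c, t⟩
  rw [submatrix_apply]
  by_cases hkl : k = l
  · subst hkl
    have h1 : (1 : Matrix (SummandIndex n) (SummandIndex n) K) ⟨k, b, s⟩ ⟨k, c, t⟩ =
        if b = c ∧ s = t then 1 else 0 := by
      rw [Matrix.one_apply]
      simp
    rw [h1]
    by_cases hk : Even (planeVertex k).label
    · rw [copiesOfIndex, dif_neg (not_not.2 hk), copiesOfIndex, dif_pos hk]
      exact blockMatrix_lineCopy_planeCopy K hn k _ _ b c s t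
    · rw [copiesOfIndex, dif_pos hk, copiesOfIndex, dif_neg hk]
      exact blockMatrix_planeCopy_lineCopy K hn k _ _ b c s t
  · rw [Matrix.one_apply_ne (by simp [hkl]), blockMatrix_apply]
    obtain ⟨i, hi⟩ := exists_copiesOfIndex_snd hn (fun x => ¬ Even x.label)
      not_even_lineVertex ⟨k, b, s⟩
    obtain ⟨j, hj⟩ := exists_copiesOfIndex_snd hn (fun x => Even x.label)
      even_label_lineVertex ⟨l, c, t⟩
    refine Finset.sum_eq_zero fun a _ => ?_
    rw [hi, hj, kroneckerSum_apply_ne K hn a hkl, mul_zero]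

end SemiInvariant

/-! ### The determinantal semi-invariant -/

section Determinant

variable {n : ℕ}

theorem copiesOfIndex_bijective_not_even (hn : 2 ≤ n) :
    Function.Bijective (copiesOfIndex hn (fun x => ¬ Even x.label) not_even_lineVertex) := by
  refine (Fintype.bijective_iff_injective_and_card _).2
    ⟨fun h h' e => ?_, (card_copiesBasis hn _ not_even_lineVertex).symm⟩
  by_contra hne
  have key := blockMatrix_kroneckerSum ℚ hn
  have h1 := congrFun₂ key h h'
  have h2 := congrFun₂ key h' h'
  rw [submatrix_apply] at h1 h2
  rw [e, h2, Matrix.one_apply_eq, Matrix.one_apply_ne hne] at h1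
  exact one_ne_zero h1

theorem copiesOfIndex_bijective_even (hn : 2 ≤ n) :
    Function.Bijective (copiesOfIndex hn (fun x => Even x.label) even_label_lineVertex) := by
  refine (Fintype.bijective_iff_injective_and_card _).2
    ⟨fun h h' e => ?_, (card_copiesBasis hn _ even_label_lineVertex).symm⟩
  by_contra hne
  have key := blockMatrix_kroneckerSum ℚ hn
  have h1 := congrFun₂ key h h'
  have h2 := congrFun₂ key h h
  rw [submatrix_apply] at h1 h2
  rw [← e, h2, Matrix.one_apply_eq, Matrix.one_apply_ne hne] at h1
  exact one_ne_zero h1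

/-- The numbering of the rows of the block matrix. -/
noncomputable def rowEquiv (hn : 2 ≤ n) :
    SummandIndex n ≃ CopiesBasis n fun x => ¬ Even x.label :=
  Equiv.ofBijective _ (copiesOfIndex_bijective_not_even hn)

/-- The numbering of the columns of the block matrix. -/
noncomputable def colEquiv (hn : 2 ≤ n) :
    SummandIndex n ≃ CopiesBasis n fun x => Even x.label :=
  Equiv.ofBijective _ (copiesOfIndex_bijective_even hn)

variable (K : Type*) [Field K]

/-- The generic representation, whose matrix entries are the coordinates. -/
noncomputable def genericRep (n : ℕ) :
    Rep (CoordRing K (Zigzag n) (zigzagDim n)) (Zigzag n) (zigzagDim n) :=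
  fun _ _ a => of fun i j => MvPolynomial.X ⟨a, i, j⟩

/-- The determinant of the block matrix, as a polynomial function on the representation space. -/
noncomputable def detSemiInvariant (hn : 2 ≤ n) : CoordRing K (Zigzag n) (zigzagDim n) :=
  ((blockMatrix (genericRep K n)).submatrix (rowEquiv hn) (colEquiv hn)).det

variable {K}

theorem value_detSemiInvariant (hn : 2 ≤ n) (V : Rep K (Zigzag n) (zigzagDim n)) :
    value V (detSemiInvariant K hn) =
      ((blockMatrix V).submatrix (rowEquiv hn) (colEquiv hn)).det := by
  rw [value, detSemiInvariant, RingHom.map_det]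
  congr 1
  ext h h'
  simp [blockMatrix_apply, genericRep]

theorem value_kroneckerSum_detSemiInvariant (hn : 2 ≤ n) :
    value (kroneckerSum K hn) (detSemiInvariant K hn) = 1 := by
  rw [value_detSemiInvariant, ← Matrix.det_one (n := SummandIndex n)]
  exact congrArg det (blockMatrix_kroneckerSum K hn)

theorem isHomogeneous_det {R τ ι : Type*} [CommRing R] [Fintype ι] [DecidableEq ι]
    {M : Matrix ι ι (MvPolynomial τ R)} (h : ∀ i j, (M i j).IsHomogeneous 1) :
    M.det.IsHomogeneous (Fintype.card ι) := by
  rw [Matrix.det_apply]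
  refine MvPolynomial.IsHomogeneous.sum _ _ _ fun σ _ => ?_
  have h2 := MvPolynomial.IsHomogeneous.prod Finset.univ (fun i => M (σ i) i)
    (fun _ => 1) (fun i _ => h _ _)
  rw [Finset.sum_const, smul_eq_mul, mul_one, Finset.card_univ] at h2
  rcases Int.units_eq_one_or (Equiv.Perm.sign σ) with h | h
  · rw [h, one_smul]
    exact h2
  · rw [h, Units.neg_smul, one_smul]
    exact h2.neg

theorem detSemiInvariant_isHomogeneous (hn : 2 ≤ n) :
    (detSemiInvariant K hn).IsHomogeneous (Fintype.card (SummandIndex n)) := by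
  refine isHomogeneous_det fun h h' => ?_
  rw [submatrix_apply, blockMatrix_apply]
  refine MvPolynomial.IsHomogeneous.sum _ _ _ fun a _ => ?_
  have h1 : ((arrowCoeff a (colEquiv hn h').1.2 (rowEquiv hn h).1.2 : ℕ) :
      CoordRing K (Zigzag n) (zigzagDim n)) = MvPolynomial.C (arrowCoeff a _ _ : K) :=
    (map_natCast MvPolynomial.C _).symm
  rw [h1]
  exact MvPolynomial.isHomogeneous_C_mul_X _ _

theorem prod_copies {M : Type*} [CommMonoid M] (p : Zigzag n → Prop) [DecidablePred p]
    (g : Zigzag n → M) :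
    ∏ c : Copies n p, g c.1 = ∏ x : {x // p x}, g x.1 ^ 2 ^ (x.1.label - 1) := by
  rw [Fintype.prod_sigma]
  simp

theorem detSemiInvariant_mem_SIweight (hn : 2 ≤ n) :
    detSemiInvariant K hn ∈ SIweight K (zigzagDim n) (zigzagWeight n) := by
  intro A V
  rw [value_detSemiInvariant, value_detSemiInvariant, blockMatrix_act,
    ← submatrix_mul_equiv _ _ _ (colEquiv hn), ← submatrix_mul_equiv _ _ _ (rowEquiv hn),
    det_mul, det_mul, det_submatrix_equiv_self, det_submatrix_equiv_self,
    det_blockDiagonal', det_blockDiagonal', mul_right_comm]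
  congr 1
  have h1 : ∏ c : Copies n fun x => ¬ Even x.label, (A⁻¹ c.1.1).val.det =
      ((∏ x : {x : Zigzag n // ¬ Even x.label},
        GeneralLinearGroup.det (A x.1) ^ zigzagWeight n x.1 : Kˣ) : K) := by
    rw [prod_copies _ fun x => (A⁻¹ x).val.det, Units.coe_prod]
    refine Finset.prod_congr rfl fun x _ => ?_
    rw [zigzagWeight_of_not_even x.2, _root_.zpow_neg, ← _root_.inv_zpow, ← map_inv]
    norm_cast
  have h2 : ∏ c : Copies n fun x => Even x.label, ((A⁻¹ c.1.1)⁻¹).val.det =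
      ((∏ x : {x : Zigzag n // Even x.label},
        GeneralLinearGroup.det (A x.1) ^ zigzagWeight n x.1 : Kˣ) : K) := by
    rw [prod_copies _ fun x => ((A⁻¹ x)⁻¹).val.det, Units.coe_prod]
    refine Finset.prod_congr rfl fun x _ => ?_
    rw [zigzagWeight_of_even x.2, Pi.inv_apply, inv_inv]
    norm_cast
  rw [h1, h2, mul_comm, ← Units.val_mul, character,
    Fintype.prod_subtype_mul_prod_subtype (fun x : Zigzag n => Even x.label)
      fun x => GeneralLinearGroup.det (A x) ^ zigzagWeight n x]

end Determinant

/-! ### Weights of the semi-invariants that do not vanish on the direct sum -/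

section Weights

variable {n : ℕ} {K : Type*} [Field K]

theorem prod_zpow_eq_zpow_sum {ι G : Type*} [CommGroup G] (s : Finset ι) (u : G) (g : ι → ℤ) :
    ∏ i ∈ s, u ^ g i = u ^ ∑ i ∈ s, g i := by
  classical
  induction s using Finset.induction_on with
  | empty => simp
  | insert i s hi ih => rw [Finset.prod_insert hi, Finset.sum_insert hi, ih, _root_.zpow_add]

theorem semiInvariant_value_smul {σ : Zigzag n → ℤ} {f : CoordRing K (Zigzag n) (zigzagDim n)}
    (hf : f ∈ SIweight K (zigzagDim n) σ) (V : Rep K (Zigzag n) (zigzagDim n)) (u : Kˣ) :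
    value (fun x y a => (u : K) • V (x := x) (y := y) a) f =
      ((u ^ scalingDegree σ : Kˣ) : K) * value V f := by
  -- all arrows run from even to odd vertices, so the scalar `u⁻¹` at the even vertices
  -- multiplies `V` by `u`
  let A : GLdim K (Zigzag n) (zigzagDim n) := fun x =>
    if Even x.label then GeneralLinearGroup.scalar _ u else 1
  have hA : act A⁻¹ V = fun x y a => (u : K) • V (x := x) (y := y) a := by
    funext x y a
    rw [act_apply]
    have h1 : (A⁻¹ y).val = 1 := by
      simp [A, hom_not_even a]
    have h2 : ((A⁻¹ x)⁻¹).val = (u : K) • 1 := by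
      simp [A, hom_even a, smul_one_eq_diagonal]
    rw [h1, h2, Matrix.one_mul, Matrix.mul_smul, Matrix.mul_one]
  have hc : character σ A = u ^ scalingDegree σ := by
    rw [character, scalingDegree, ← prod_zpow_eq_zpow_sum]
    refine Finset.prod_congr rfl fun x _ => ?_
    by_cases hx : Even x.label
    · have h1 : GeneralLinearGroup.det (A x) = u ^ (zigzagDim n x) := by
        ext
        simp [A, hx]
      rw [h1, if_pos hx, ← zpow_natCast, ← _root_.zpow_mul]
    · simp [A, hx]
  rw [← hA, hf A V, hc]

/-- The automorphism of the direct sum that multiplies the `k`-th summand by `u`. -/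
noncomputable def summandScaling (K : Type*) [Field K] (hn : 2 ≤ n) (k : Fin (n - 1)) (u : Kˣ) :
    GLdim K (Zigzag n) (zigzagDim n) :=
  fun x => GeneralLinearGroup.mk'' (reindex (basisEquiv hn x) (basisEquiv hn x)
    (diagonal fun i : SummandBasis n x => if i.1 = k then (u : K) else 1)) (by
      rw [det_reindex_self, det_diagonal, isUnit_iff_ne_zero, Finset.prod_ne_zero_iff]
      intro i _
      split_ifs <;> simp)

theorem act_summandScaling (hn : 2 ≤ n) (k : Fin (n - 1)) (u : Kˣ) :
    act (summandScaling K hn k u) (kroneckerSum K hn) = kroneckerSum K hn := by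
  funext x y a
  have key : (summandScaling K hn k u y).val * kroneckerSum K hn a =
      kroneckerSum K hn a * (summandScaling K hn k u x).val := by
    ext i j
    obtain ⟨⟨p, i⟩, rfl⟩ := (basisEquiv hn y).surjective i
    obtain ⟨⟨q, j⟩, rfl⟩ := (basisEquiv hn x).surjective j
    have h1 : (summandScaling K hn k u y).val = reindex (basisEquiv hn y) (basisEquiv hn y)
      (diagonal fun i : SummandBasis n y => if i.1 = k then (u : K) else 1) := rfl
    have h2 : (summandScaling K hn k u x).val = reindex (basisEquiv hn x) (basisEquiv hn x)
      (diagonal fun i : SummandBasis n x => if i.1 = k then (u : K) else 1) := rfl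
    rw [h1, h2, kroneckerSum]
    simp only [reindex_apply, submatrix_mul_equiv, submatrix_apply, Equiv.symm_apply_apply,
      diagonal_mul, mul_diagonal]
    by_cases hpq : p = q
    · subst hpq
      exact mul_comm _ _
    · rw [blockDiagonal'_apply_ne _ _ _ hpq, mul_zero, zero_mul]
  rw [act_apply, key, Matrix.mul_assoc, ← Units.val_mul, mul_inv_cancel, Units.val_one,
    Matrix.mul_one]

theorem det_summandScaling (hn : 2 ≤ n) (k : Fin (n - 1)) (u : Kˣ) (x : Zigzag n) :
    GeneralLinearGroup.det (summandScaling K hn k u x) = u ^ kroneckerDim n (k.val + 1) x := by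
  ext
  change (reindex (basisEquiv hn x) (basisEquiv hn x)
    (diagonal fun i : SummandBasis n x => if i.1 = k then (u : K) else 1)).det = _
  rw [det_reindex_self, det_diagonal, Fintype.prod_sigma, Finset.prod_eq_single k]
  · simp
  · intro l _ hl
    simp [hl]
  · simp

theorem value_ne_zero_relation [Infinite K] (hn : 2 ≤ n) {σ : Zigzag n → ℤ}
    {f : CoordRing K (Zigzag n) (zigzagDim n)} (hf : f ∈ SIweight K (zigzagDim n) σ)
    (hR : value (kroneckerSum K hn) f ≠ 0) (k : Fin (n - 1)) :
    2 * σ (planeVertex k) + σ (lineVertex k) = 0 := by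
  by_contra hm
  obtain ⟨u, hu⟩ := exists_unit_zpow_ne_one K hm
  apply hu
  have h1 := hf (summandScaling K hn k u)⁻¹ (kroneckerSum K hn)
  rw [inv_inv, act_summandScaling] at h1
  have h2 : character σ (summandScaling K hn k u)⁻¹ =
      (u ^ (2 * σ (planeVertex k) + σ (lineVertex k)))⁻¹ := by
    rw [character, ← sum_kroneckerDim_mul, ← prod_zpow_eq_zpow_sum, ← Finset.prod_inv_distrib]
    refine Finset.prod_congr rfl fun x _ => ?_
    rw [Pi.inv_apply, map_inv, det_summandScaling, ← zpow_natCast, _root_.inv_zpow,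
      ← _root_.zpow_mul]
  rw [h2] at h1
  have h3 := mul_right_cancel₀ hR ((one_mul _).trans h1)
  rw [← inv_eq_one, ← Units.val_eq_one, ← h3]

/-- Only the nonnegative multiples of the weight `(-1, 2, -4, 8, …)` have semi-invariants that do
not vanish at the direct sum. -/
theorem exists_eq_nsmul_of_value_ne_zero [Infinite K] (hn : 2 ≤ n) {σ : Zigzag n → ℤ}
    {f : CoordRing K (Zigzag n) (zigzagDim n)} (hf : f ∈ SIweight K (zigzagDim n) σ)
    (hR : value (kroneckerSum K hn) f ≠ 0) : ∃ m : ℕ, σ = m • zigzagWeight n := by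
  obtain ⟨c, rfl⟩ := eq_smul_zigzagWeight hn (value_ne_zero_relation hn hf hR)
  rcases le_or_gt 0 c with hc | hc
  · lift c to ℕ using hc
    exact ⟨c, natCast_zsmul _ _⟩
  · exfalso
    -- a negative scaling degree would make the value on the line through `R` a nonzero Laurent
    -- monomial of negative degree, but it is a polynomial
    obtain ⟨p, hp⟩ := exists_eval_eq_value_smul (kroneckerSum K hn) f
    have h2n : (2 : ℤ) < 2 ^ n := by
      calc (2 : ℤ) < 2 ^ 2 := by norm_num
        _ ≤ 2 ^ n := pow_le_pow_right₀ (by norm_num) hn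
    have hdeg : scalingDegree (c • zigzagWeight n) < 0 := by
      rw [scalingDegree_smul_zigzagWeight hn]
      exact mul_neg_of_neg_of_pos hc (by omega)
    obtain ⟨d, hd⟩ := Int.eq_ofNat_of_zero_le (neg_nonneg.2 hdeg.le)
    have hs : scalingDegree (c • zigzagWeight n) = -(d : ℤ) := by omega
    have hd' : d ≠ 0 := by omega
    have hq : Polynomial.X * (p * Polynomial.X ^ d -
        Polynomial.C (value (kroneckerSum K hn) f)) = 0 := by
      refine Polynomial.funext fun r => ?_
      rcases eq_or_ne r 0 with rfl | hr
      · simp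
      · have h1 := semiInvariant_value_smul hf (kroneckerSum K hn) (Units.mk0 r hr)
        rw [Units.val_mk0, ← hp, hs, _root_.zpow_neg, zpow_natCast] at h1
        simp [h1, hr]
        field_simp
        simp
    have h3 := (mul_eq_zero.1 hq).resolve_left Polynomial.X_ne_zero
    have h4 := congrArg (Polynomial.eval 0) h3
    simp [hd'] at h4
    exact hR h4

theorem value_eq_zero_of_weightSize_lt [Infinite K] (hn : 2 ≤ n) {σ : Zigzag n → ℤ} (hσ : σ ≠ 0)
    (hlt : weightSize (zigzagDim n) σ < 2 ^ n - 2)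
    {f : CoordRing K (Zigzag n) (zigzagDim n)} (hf : f ∈ SIweight K (zigzagDim n) σ) :
    value (kroneckerSum K hn) f = 0 := by
  by_contra hR
  obtain ⟨m, rfl⟩ := exists_eq_nsmul_of_value_ne_zero hn hf hR
  rw [weightSize_nsmul_zigzagWeight hn] at hlt
  have hm : m ≠ 0 := by
    rintro rfl
    exact hσ (zero_smul ℕ _)
  have hm1 : (1 : ℤ) ≤ m := by exact_mod_cast Nat.one_le_iff_ne_zero.2 hm
  have h2n : (2 : ℤ) ^ 1 ≤ 2 ^ n := pow_le_pow_right₀ (by norm_num) (by omega)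
  nlinarith

theorem kroneckerSum_notMem_nullCone (hn : 2 ≤ n) :
    kroneckerSum K hn ∉ nullCone K (Zigzag n) (zigzagDim n) := by
  intro h
  have hpos : 0 < Fintype.card (SummandIndex n) :=
    Fintype.card_pos_iff.2 ⟨⟨⟨0, by omega⟩, 0, ⟨0, by simp⟩⟩⟩
  have h1 := h _ (SIweight_le_SI _ (detSemiInvariant_mem_SIweight hn)) _ hpos
    (detSemiInvariant_isHomogeneous hn)
  rw [value_kroneckerSum_detSemiInvariant] at h1
  exact one_ne_zero h1

theorem semistable_kroneckerSum_iff [Infinite K] (hn : 2 ≤ n) (σ : Zigzag n → ℤ) :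
    Semistable (kroneckerSum K hn) σ ↔ ∃ m : ℕ, σ = m • zigzagWeight n := by
  constructor
  · rintro ⟨d, hd, f, hf, hR⟩
    have h1 := value_ne_zero_relation hn hf hR
    obtain ⟨m, hm⟩ := exists_eq_nsmul_of_value_ne_zero hn hf hR
    have h2 : ∀ k : Fin (n - 1), 2 * σ (planeVertex k) + σ (lineVertex k) = 0 := by
      intro k
      have h3 := h1 k
      simp only [Pi.smul_apply, nsmul_eq_mul] at h3
      have hd0 : (d : ℤ) ≠ 0 := by exact_mod_cast hd.ne'
      refine (mul_eq_zero.1 (?_ : (d : ℤ) * _ = 0)).resolve_left hd0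
      linarith
    obtain ⟨c, rfl⟩ := eq_smul_zigzagWeight hn h2
    have h4 := congrFun hm (planeVertex ⟨0, by omega⟩)
    have h5 : zigzagWeight n (planeVertex ⟨0, by omega⟩) = -1 := by simp [zigzagWeight]
    simp only [Pi.smul_apply, h5, nsmul_eq_mul, smul_eq_mul] at h4
    have hc : 0 ≤ c := by
      by_contra hneg
      have : (d : ℤ) * c < 0 := mul_neg_of_pos_of_neg (by exact_mod_cast hd) (by omega)
      have : (0 : ℤ) ≤ m := by positivity
      linarith
    lift c to ℕ using hc
    exact ⟨c, natCast_zsmul _ _⟩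
  · rintro ⟨m, rfl⟩
    refine ⟨1, one_pos, detSemiInvariant K hn ^ m, ?_, ?_⟩
    · rw [one_smul]
      exact pow_mem_SIweight (detSemiInvariant_mem_SIweight hn) m
    · have h := value_kroneckerSum_detSemiInvariant (K := K) hn
      rw [value] at h ⊢
      rw [map_pow, h, one_pow]
      exact one_ne_zero

end Weights

/-! ### Null cone, generators and growth -/

section Bounds

variable {n : ℕ} {K : Type*} [Field K] [Infinite K]

theorem not_defineNullCone (hn : 2 ≤ n) {S : Set (Zigzag n → ℤ)}
    (hS : ∀ σ ∈ S, weightSize (zigzagDim n) σ < 2 ^ n - 2) :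
    ¬ DefineNullCone K (zigzagDim n) S := fun h =>
  kroneckerSum_notMem_nullCone (K := K) hn
    (h.subset fun _ hσ h0 _ hf => value_eq_zero_of_weightSize_lt hn h0 (hS _ hσ) hf)

/-- Semi-invariants of small weights do not distinguish the direct sum from the zero
representation. -/
theorem value_kroneckerSum_eq_value_zero (hn : 2 ≤ n) {σ : Zigzag n → ℤ}
    (hlt : weightSize (zigzagDim n) σ < 2 ^ n - 2)
    {f : CoordRing K (Zigzag n) (zigzagDim n)} (hf : f ∈ SIweight K (zigzagDim n) σ) :
    value (kroneckerSum K hn) f = value (fun _ _ _ => 0) f := by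
  obtain ⟨p, hp⟩ := exists_eval_eq_value_smul (kroneckerSum K hn) f
  have hq : Polynomial.X * (p - Polynomial.C (value (kroneckerSum K hn) f)) = 0 := by
    refine Polynomial.funext fun r => ?_
    rcases eq_or_ne r 0 with rfl | hr
    · simp
    · have h1 := semiInvariant_value_smul hf (kroneckerSum K hn) (Units.mk0 r hr)
      rw [Units.val_mk0, ← hp] at h1
      rcases eq_or_ne σ 0 with rfl | hσ
      · simp [h1, scalingDegree]
      · simp [h1, value_eq_zero_of_weightSize_lt hn hσ hlt hf]
  have h3 := (mul_eq_zero.1 hq).resolve_left Polynomial.X_ne_zero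
  have h4 := congrArg (Polynomial.eval 0) h3
  rw [Polynomial.eval_sub, hp, Polynomial.eval_C, Polynomial.eval_zero, sub_eq_zero] at h4
  rw [← h4]
  simp only [zero_smul]

theorem not_generateSI (hn : 2 ≤ n) {S : Set (Zigzag n → ℤ)}
    (hS : ∀ σ ∈ S, weightSize (zigzagDim n) σ < 2 ^ n - 2) :
    ¬ GenerateSI K (zigzagDim n) S := by
  intro h
  have hmem : detSemiInvariant K hn ∈ Algebra.adjoin K
      (⋃ σ ∈ S, (SIweight K (zigzagDim n) σ : Set (CoordRing K (Zigzag n) (zigzagDim n)))) :=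
    h.symm ▸ SIweight_le_SI _ (detSemiInvariant_mem_SIweight hn)
  have key : ∀ f ∈ Algebra.adjoin K
      (⋃ σ ∈ S, (SIweight K (zigzagDim n) σ : Set (CoordRing K (Zigzag n) (zigzagDim n)))),
      value (kroneckerSum K hn) f = value (fun _ _ _ => 0) f := by
    intro f hf
    induction hf using Algebra.adjoin_induction with
    | mem f hf =>
      obtain ⟨σ, hσ, hf⟩ := Set.mem_iUnion₂.1 hf
      exact value_kroneckerSum_eq_value_zero hn (hS σ hσ) hf
    | algebraMap r => simp [value, MvPolynomial.algebraMap_eq]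
    | add f g _ _ hf hg =>
      simp only [value, map_add] at hf hg ⊢
      rw [hf, hg]
    | mul f g _ _ hf hg =>
      simp only [value, map_mul] at hf hg ⊢
      rw [hf, hg]
  have h1 := key _ hmem
  have hpos : Nonempty (SummandIndex n) := ⟨⟨⟨0, by omega⟩, 0, ⟨0, by simp⟩⟩⟩
  have h0 : (blockMatrix (fun _ _ _ => 0 : Rep K (Zigzag n) (zigzagDim n))) = 0 := by
    ext r c
    simp [blockMatrix_apply]
  rw [value_kroneckerSum_detSemiInvariant, value_detSemiInvariant, h0, submatrix_zero] at h1
  simp at h1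

end Bounds

theorem eventually_polynomial_lt_two_pow (P : Polynomial ℝ) :
    ∀ᶠ n : ℕ in Filter.atTop, P.eval (n : ℝ) < 2 ^ n - 2 := by
  have h1 : (fun n : ℕ => P.eval (n : ℝ) + 2) =o[Filter.atTop] fun n : ℕ => (2 : ℝ) ^ n := by
    have h2 : ∀ Q : Polynomial ℝ,
        (fun n : ℕ => Q.eval (n : ℝ)) =o[Filter.atTop] fun n : ℕ => (2 : ℝ) ^ n := by
      intro Q
      simp only [Polynomial.eval_eq_sum_range]
      exact Asymptotics.IsLittleO.fun_sum fun i _ =>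
        (isLittleO_pow_const_const_pow_of_one_lt (R := ℝ) i one_lt_two).const_mul_left (Q.coeff i)
    exact (h2 (P + Polynomial.C 2)).congr_left fun n => by
      rw [Polynomial.eval_add, Polynomial.eval_C]
  filter_upwards [h1.bound (c := 1 / 2) (by norm_num)] with n hn
  have h3 : (0 : ℝ) < 2 ^ n := by positivity
  rw [Real.norm_eq_abs, Real.norm_eq_abs, abs_of_pos h3] at hn
  linarith [le_abs_self (P.eval (n : ℝ) + 2)]

end QuiverSI

theorem proposition1p5 (K : Type*) [Field K] [Infinite K] :
    (∀ n : ℕ, 2 ≤ n →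
      ¬ QuiverSI.DefineNullCone K (QuiverSI.zigzagDim n)
          {σ | QuiverSI.weightSize (QuiverSI.zigzagDim n) σ < 2 ^ n - 2} ∧
      ¬ QuiverSI.GenerateSI K (QuiverSI.zigzagDim n)
          {σ | QuiverSI.weightSize (QuiverSI.zigzagDim n) σ < 2 ^ n - 2} ∧
      ∃ R : QuiverSI.Rep K (QuiverSI.Zigzag n) (QuiverSI.zigzagDim n),
        QuiverSI.IsDirectSum
          (fun k : Fin (n - 1) => QuiverSI.kroneckerRep K n (k.val + 1)) R ∧
        R ∉ QuiverSI.nullCone K (QuiverSI.Zigzag n) (QuiverSI.zigzagDim n) ∧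
        (∀ σ : QuiverSI.Zigzag n → ℤ, σ ≠ 0 →
          QuiverSI.weightSize (QuiverSI.zigzagDim n) σ < 2 ^ n - 2 →
          ∀ f ∈ QuiverSI.SIweight K (QuiverSI.zigzagDim n) σ, QuiverSI.value R f = 0) ∧
        ∀ σ : QuiverSI.Zigzag n → ℤ,
          QuiverSI.Semistable R σ ↔ ∃ m : ℕ, σ = m • QuiverSI.zigzagWeight n) ∧
    (∀ P : Polynomial ℝ, ∃ N : ℕ, ∀ n : ℕ, 2 ≤ n → N ≤ n →
      ¬ QuiverSI.DefineNullCone K (QuiverSI.zigzagDim n)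
          {σ | (QuiverSI.weightSize (QuiverSI.zigzagDim n) σ : ℝ) ≤ P.eval (n : ℝ)} ∧
      ¬ QuiverSI.GenerateSI K (QuiverSI.zigzagDim n)
          {σ | (QuiverSI.weightSize (QuiverSI.zigzagDim n) σ : ℝ) ≤ P.eval (n : ℝ)}) := by
  refine ⟨fun n hn => ⟨QuiverSI.not_defineNullCone hn fun _ h => h,
    QuiverSI.not_generateSI hn fun _ h => h, QuiverSI.kroneckerSum K hn,
    ⟨QuiverSI.basisEquiv hn, fun _ _ _ => rfl⟩, QuiverSI.kroneckerSum_notMem_nullCone hn,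
    fun σ hσ hlt f hf => QuiverSI.value_eq_zero_of_weightSize_lt hn hσ hlt hf,
    QuiverSI.semistable_kroneckerSum_iff hn⟩, fun P => ?_⟩
  obtain ⟨N, hN⟩ := Filter.eventually_atTop.1 (QuiverSI.eventually_polynomial_lt_two_pow P)
  refine ⟨N, fun n hn hNn => ?_⟩
  have hS : ∀ σ ∈ {σ : QuiverSI.Zigzag n → ℤ |
      (QuiverSI.weightSize (QuiverSI.zigzagDim n) σ : ℝ) ≤ P.eval (n : ℝ)},
      QuiverSI.weightSize (QuiverSI.zigzagDim n) σ < 2 ^ n - 2 := by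
    intro σ hσ
    have h1 := lt_of_le_of_lt hσ (hN n hNn)
    exact_mod_cast h1
  exact ⟨QuiverSI.not_defineNullCone hn hS, QuiverSI.not_generateSI hn hS⟩
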